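/- A Markov decision process (MDP) $\mathcal M=(S,S_\Box,S_\bigcirc,\to,P)$ consists of a countable set $S$ of states, partitioned into player states $S_\Box$ and random states $S_\bigcirc$, a transition relation $\to\;\subseteq S\times S$ such that every state has a successor, and a probability distribution $P(s)$ over the successors of $s$ for each random state $s\in S_\bigcirc$. It is finitely branching if every state has only finitely many successors. A strategy $\sigma$ assigns to each finite sequence of states $ws\in S^*S_\Box$ ending in a player state $s$ a probability distribution over the successors of $s$; it is memoryless deterministic (MD) if this is always a Dirac distribution that depends only on $s$. A strategy $\sigma$ and an initial state $s$ induce in the usual way a probability measure $\mathcal P_{\mathcal M,s,\sigma}$ on infinite sequences of states starting in $s$. For an objective (a measurable set of infinite sequences) $\varphi$, the value of $s$ is $\mathrm{val}_{\mathcal M}(s)=\sup_\sigma \mathcal P_{\mathcal M,s,\sigma}(\varphi)$, the supremum being over all strategies, and $\sigma$ is optimal from $s$ if $\mathcal P_{\mathcal M,s,\sigma}(\varphi)=\mathrm{val}_{\mathcal M}(s)$. **Theorem.** Let $\mathcal M$ be a countable, finitely branching MDP, let $\mathit{Col}:S\to\{0,1,2\}$ be a colour function, and let $\varphi$ be the parity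 objective: the set of infinite sequences of states in which the largest colour that occurs infinitely often is even. Then there is an MD strategy $\hat\sigma$ that is optimal from every state from which some strategy is optimal: for every $s\in S$, if there is a strategy $\sigma$ with $\mathcal P_{\mathcal M,s,\sigma}(\varphi)=\mathrm{val}_{\mathcal M}(s)$, then $\mathcal P_{\mathcal M,s,\hat\sigma}(\varphi)=\mathrm{val}_{\mathcal M}(s)$. -/

import Mathlib

open MeasureTheory ProbabilityTheory Filter
open scoped ENNReal

/-- A Markov decision process with state space `S`. The set `player` holds the states of the player,
its complement the random states. Every state has a successor, and a random state `s` comes with a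
probability distribution `prob s` over its successors. -/
structure MDP (S : Type*) where
  player : Set S
  step : S → S → Prop
  exists_step : ∀ s, ∃ t, step s t
  prob : {s : S // s ∉ player} → PMF S
  step_of_mem_support : ∀ s, ∀ t ∈ (prob s).support, step s t

namespace MDP

variable {S : Type*}

/-- Each state has only finitely many successors. -/
def FinitelyBranching (M : MDP S) : Prop :=
  ∀ s, {t | M.step s t}.Finite

/-- A (history-dependent, randomized) strategy. Given a finite sequence `w s` of states that ends in
a player state `s`, it chooses a distribution `choice w s` over the successors of `s`. -/
structure Strategy (M : MDP S) where
  choice : List S → {s : S // s ∈ M.player} → PMF S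
  step_of_mem_support : ∀ w s, ∀ t ∈ (choice w s).support, M.step s t

namespace Strategy

variable {M : MDP S}

/-- A memoryless deterministic (MD) strategy: the choice is a Dirac distribution that depends only
on the current state. -/
def IsMD (σ : M.Strategy) : Prop :=
  ∃ f : {s : S // s ∈ M.player} → S, ∀ w s, σ.choice w s = PMF.pure (f s)

open Classical in
/-- The distribution of the next state after the finite sequence `w s`: the one chosen by the strategy
if `s` is a player state, the one given by the MDP if `s` is a random state. -/
noncomputable def next (σ : M.Strategy) (w : List S) (s : S) : PMF S :=
  if h : s ∈ M.player then σ.choice w ⟨s, h⟩ else M.prob ⟨s, h⟩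

variable [Countable S] [MeasurableSpace S] [DiscreteMeasurableSpace S]

/-- The transition kernel from the states `h 0, …, h n` visited so far to the state at time `n + 1`. -/
noncomputable def kernel (σ : M.Strategy) (n : ℕ) : Kernel (Finset.Iic n → S) S :=
  Kernel.ofFunOfCountable fun h =>
    (σ.next (List.ofFn fun i : Fin n => h ⟨i, Finset.mem_Iic.2 i.2.le⟩)
      (h ⟨n, Finset.mem_Iic.2 le_rfl⟩)).toMeasure

instance (σ : M.Strategy) (n : ℕ) : IsMarkovKernel (σ.kernel n) :=
  ⟨fun _ => PMF.toMeasure.isProbabilityMeasure _⟩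

/-- The probability measure on infinite sequences of states that the strategy `σ` induces from the
initial state `s`. -/
noncomputable def playMeasure (σ : M.Strategy) (s : S) : Measure (ℕ → S) :=
  Kernel.trajMeasure (X := fun _ => S) (Measure.dirac s) σ.kernel

end Strategy

/-- The parity objective of a colour function: the largest colour that occurs infinitely often is
even. -/
def parity (col : S → ℕ) : Set (ℕ → S) :=
  {w | ∃ i : ℕ, (∃ᶠ n in atTop, col (w n) = 2 * i) ∧ ∀ᶠ n in atTop, col (w n) ≤ 2 * i}

variable [Countable S] [MeasurableSpace S] [DiscreteMeasurableSpace S]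

/-- The value of a state: the supremum, over all strategies, of the probability that the objective
`φ` is achieved. -/
noncomputable def value (M : MDP S) (φ : Set (ℕ → S)) (s : S) : ℝ≥0∞ :=
  ⨆ σ : M.Strategy, σ.playMeasure s φ

/-- The strategy `σ` attains the value of the state `s`. -/
def Strategy.IsOptimalFrom {M : MDP S} (σ : M.Strategy) (φ : Set (ℕ → S)) (s : S) : Prop :=
  M.value φ s ≤ σ.playMeasure s φ

end MDP

/-!
With colours `0, 1, 2`, the parity objective says that colour `2` occurs infinitely often or that
colour `0` is eventually never left. An optimal strategy remains optimal after each step and, by the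
optimality equation, only moves from a player state to states of the same value. Reweighting the
transitions by the value (Doob's transform) therefore gives a decision process in which this
objective has value one in each state, and Dirac decisions remain Dirac decisions.

In the transformed process, let `Z` be the set of states of colour `0` and `T` the set of states
that have colour `2` or allow one to stay in `Z` forever with probability at least `2/3`. A subset
of `Z` in which the latter probability is less than `2/3` cannot be inhabited forever with positive
probability at all, so `T` can be reached almost surely. This remains true if, in all states where
the probability of staying in `Z` can be made at least `1/3`, a decision that maximizes it is
imposed: such a decision exists as the process is finitely branching. A memoryless deterministic
policy `g` then reaches `T` almost surely from everywhere. It is obtained by restricting the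
decisions successively, for each state in turn, such that all the remaining policies reach `T` from
that state with probability at least `1/3`. From the states of `T` that do not have colour `2`, the
imposed decisions make `g` stay in `Z` forever with probability at least `1/3`, since this only
costs the probability of ever dropping below `1/3`. By a zero-one law `g` wins almost surely, and
undoing the transform bounds its winning probability in the original process below by the value.
-/

namespace MDP

/-! ### Path measures -/

section PathMeasure

variable {S : Type*}

/-- The sequence that starts with `s` and continues with `w`. -/
def pathCons (s : S) (w : ℕ → S) : ℕ → S
  | 0 => s
  | n + 1 => w n

@[simp] lemma pathCons_zero (s : S) (w : ℕ → S) : pathCons s w 0 = s := rfl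

@[simp] lemma pathCons_succ (s : S) (w : ℕ → S) (n : ℕ) : pathCons s w (n + 1) = w n := rfl

lemma preimage_pathCons_cylinder_succ (s : S) (x : ℕ → S) (n : ℕ) :
    pathCons s ⁻¹' PiNat.cylinder x (n + 1) =
      {_w | x 0 = s} ∩ PiNat.cylinder (fun i => x (i + 1)) n := by
  ext w
  change (∀ i < n + 1, pathCons s w i = x i) ↔ _
  rw [Nat.forall_lt_succ_left]
  simp [PiNat.cylinder, eq_comm]

lemma preimage_pathCons_forall_lt_succ (s : S) (H : Set S) (n : ℕ) :
    pathCons s ⁻¹' {w | ∀ i < n + 1, w i ∈ H} = {_w | s ∈ H} ∩ {w | ∀ i < n, w i ∈ H} := by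
  ext w
  exact Nat.forall_lt_succ_left

lemma preimage_pathCons_exists_lt_succ (s : S) (T : Set S) (n : ℕ) :
    pathCons s ⁻¹' {w | ∃ i < n + 1, w i ∈ T} = {_w | s ∈ T} ∪ {w | ∃ i < n, w i ∈ T} := by
  ext w
  exact Nat.exists_lt_succ_left

lemma preimage_frestrictLe_singleton (x : ℕ → S) (n : ℕ) :
    Preorder.frestrictLe (π := fun _ : ℕ => S) n ⁻¹' {Preorder.frestrictLe n x} =
      PiNat.cylinder x (n + 1) := by
  ext w
  simp [funext_iff, PiNat.cylinder]

variable [MeasurableSpace S]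

lemma measurable_pathCons (s : S) : Measurable (pathCons s) := by
  refine measurable_pi_lambda _ fun n => ?_
  cases n with
  | zero => exact measurable_const
  | succ n => exact measurable_pi_apply n

lemma measure_le_of_isSetAlgebra {α : Type*} [m : MeasurableSpace α] {μ ν : Measure α}
    [IsFiniteMeasure μ] [IsFiniteMeasure ν] {𝒜 : Set (Set α)} (h𝒜 : IsSetAlgebra 𝒜)
    (hgen : m = MeasurableSpace.generateFrom 𝒜) (h : ∀ B ∈ 𝒜, ν B ≤ μ B) : ν ≤ μ := by
  refine Measure.le_iff.2 fun A hA => ENNReal.le_of_forall_pos_le_add fun ε hε _ => ?_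
  obtain ⟨B, hB, hBA⟩ := exists_measure_symmDiff_lt_of_generateFrom_isSetRing (μ := μ + ν)
    h𝒜.isSetRing ⟨{Set.univ}, Set.countable_singleton _, by simpa using h𝒜.univ_mem, by simp⟩
    hgen hA (ENNReal.coe_pos.2 hε)
  calc ν A ≤ ν B + ν (symmDiff B A) := by
        rw [symmDiff_comm]; exact tsub_le_iff_left.1 le_measure_symmDiff
    _ ≤ μ B + ν (symmDiff B A) := by gcongr ?_ + _; exact h B hB
    _ ≤ μ A + μ (symmDiff B A) + ν (symmDiff B A) := by
        gcongr; exact tsub_le_iff_left.1 le_measure_symmDiff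
    _ = μ A + (μ + ν) (symmDiff B A) := by rw [Measure.add_apply, add_assoc]
    _ ≤ μ A + ε := by gcongr

variable [DiscreteMeasurableSpace S]

lemma measurableSet_apply_mem (H : Set S) (n : ℕ) : MeasurableSet {w : ℕ → S | w n ∈ H} :=
  measurable_pi_apply n (.of_discrete (s := H))

lemma measurableSet_cylinder (x : ℕ → S) (n : ℕ) : MeasurableSet (PiNat.cylinder x n) := by
  simp only [PiNat.cylinder, Set.ofPred_forall]
  exact .iInter fun i => .iInter fun _ => measurableSet_apply_mem {x i} i

variable [Countable S]

lemma measure_le_of_cylinder {μ ν : Measure (ℕ → S)} [IsFiniteMeasure μ] [IsFiniteMeasure ν]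
    (h : ∀ x n, ν (PiNat.cylinder x n) ≤ μ (PiNat.cylinder x n)) : ν ≤ μ := by
  refine measure_le_of_isSetAlgebra isSetAlgebra_measurableCylinders
    generateFrom_measurableCylinders.symm fun B hB => ?_
  obtain ⟨n, C, hC, rfl⟩ : ∃ n C, MeasurableSet C ∧ B = cylinder (Finset.Iic n) C := by
    simpa [measurableCylinders_nat] using hB
  have hm : Measurable (Preorder.frestrictLe (π := fun _ : ℕ => S) n) := by fun_prop
  change ν (Preorder.frestrictLe n ⁻¹' C) ≤ μ (Preorder.frestrictLe n ⁻¹' C)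
  rw [← Measure.map_apply hm hC, ← Measure.map_apply hm hC,
    ← Measure.tsum_indicator_apply_singleton _ _ hC,
    ← Measure.tsum_indicator_apply_singleton _ _ hC]
  refine ENNReal.tsum_le_tsum fun y => Set.indicator_le_indicator ?_
  rw [Measure.map_apply hm (measurableSet_singleton y),
    Measure.map_apply hm (measurableSet_singleton y)]
  obtain hy | ⟨x, rfl⟩ :=
    (Preorder.frestrictLe (π := fun _ : ℕ => S) n ⁻¹' {y}).eq_empty_or_nonempty
  · simp [hy]
  · simpa only [preimage_frestrictLe_singleton] using h x (n + 1)

/-- The transition kernel of the process whose next state after `w s` has distribution `N w s`. -/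
noncomputable def pathKernel (N : List S → S → PMF S) (n : ℕ) : Kernel (Finset.Iic n → S) S :=
  Kernel.ofFunOfCountable fun h =>
    (N (List.ofFn fun i : Fin n => h ⟨i, Finset.mem_Iic.2 i.2.le⟩)
      (h ⟨n, Finset.mem_Iic.2 le_rfl⟩)).toMeasure

instance (N : List S → S → PMF S) (n : ℕ) : IsMarkovKernel (pathKernel N n) :=
  ⟨fun _ => PMF.toMeasure.isProbabilityMeasure _⟩

/-- The law of the process that starts in `s` and whose next state after `w t` has distribution
`N w t`. -/
noncomputable def pathMeasure (N : List S → S → PMF S) (s : S) : Measure (ℕ → S) :=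
  Kernel.trajMeasure (X := fun _ => S) (Measure.dirac s) (pathKernel N)

instance (N : List S → S → PMF S) (s : S) : IsProbabilityMeasure (pathMeasure N s) := by
  unfold pathMeasure; infer_instance

lemma pathMeasure_cylinder_one (N : List S → S → PMF S) (s : S) (x : ℕ → S) :
    pathMeasure N s (PiNat.cylinder x 1) = Set.indicator {x 0} 1 s := by
  have h : (pathMeasure N s).map (Preorder.frestrictLe 0) =
      (Measure.dirac s).map (MeasurableEquiv.piUnique (fun _ : Finset.Iic 0 => S)).symm := by
    rw [pathMeasure, Kernel.trajMeasure, Measure.map_comp _ _ (by fun_prop),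
      Kernel.traj_map_frestrictLe, Kernel.partialTraj_self, Measure.id_comp]
  have hpre : (MeasurableEquiv.piUnique (fun _ : Finset.Iic 0 => S)).symm ⁻¹'
      {Preorder.frestrictLe 0 x} = {x 0} := by
    ext t
    simp [funext_iff]
  rw [← preimage_frestrictLe_singleton, ← Measure.map_apply (by fun_prop)
    (measurableSet_singleton _), h, Measure.map_apply (by fun_prop) (measurableSet_singleton _),
    hpre, Measure.dirac_apply]

lemma pathMeasure_cylinder_add_two (N : List S → S → PMF S) (s : S) (x : ℕ → S) (n : ℕ) :
    pathMeasure N s (PiNat.cylinder x (n + 2)) =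
      pathMeasure N s (PiNat.cylinder x (n + 1)) *
        N (List.ofFn fun i : Fin n => x i) (x n) (x (n + 1)) := by
  have hstep := congrArg (· ({Preorder.frestrictLe n x} ×ˢ {x (n + 1)}))
    (Kernel.map_frestrictLe_trajMeasure_compProd_eq_map_trajMeasure
      (X := fun _ => S) (μ₀ := Measure.dirac s) (κ := pathKernel N) (a := n))
  beta_reduce at hstep
  rw [Measure.compProd_apply_prod (measurableSet_singleton _) (measurableSet_singleton _),
    Measure.restrict_singleton, lintegral_smul_measure, lintegral_dirac,
    Measure.map_apply (by fun_prop) (measurableSet_singleton _),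
    Measure.map_apply (by fun_prop) (by measurability), preimage_frestrictLe_singleton] at hstep
  have hkernel : pathKernel N n (Preorder.frestrictLe n x) {x (n + 1)} =
      N (List.ofFn fun i : Fin n => x i) (x n) (x (n + 1)) :=
    PMF.toMeasure_apply_singleton _ _ (measurableSet_singleton _)
  have hcyl : PiNat.cylinder x (n + 2) =
      (fun w : ℕ → S => (Preorder.frestrictLe (π := fun _ => S) n w, w (n + 1))) ⁻¹'
        ({Preorder.frestrictLe n x} ×ˢ {x (n + 1)}) := by
    rw [Set.mk_preimage_prod, preimage_frestrictLe_singleton]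
    ext w
    simp [PiNat.cylinder, Nat.forall_lt_succ_right]
  rw [hcyl, pathMeasure, ← hstep, hkernel, smul_eq_mul]

lemma pathMeasure_cylinder_succ (N : List S → S → PMF S) (s : S) (x : ℕ → S) (n : ℕ) :
    pathMeasure N s (PiNat.cylinder x (n + 1)) = Set.indicator {x 0} 1 s *
      ∏ i ∈ Finset.range n, N (List.ofFn fun j : Fin i => x j) (x i) (x (i + 1)) := by
  induction n with
  | zero => simp [pathMeasure_cylinder_one]
  | succ n ih => rw [pathMeasure_cylinder_add_two, ih, Finset.prod_range_succ, mul_assoc]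

lemma lintegral_pathMeasure_preimage_pathCons_cylinder (N : List S → S → PMF S) (s : S)
    (x : ℕ → S) (n : ℕ) :
    ∫⁻ t, pathMeasure (fun w => N (s :: w)) t (pathCons s ⁻¹' PiNat.cylinder x n)
      ∂(N [] s).toMeasure = pathMeasure N s (PiNat.cylinder x n) := by
  obtain _ | n := n
  · simp
  simp only [preimage_pathCons_cylinder_succ, pathMeasure_cylinder_succ N]
  obtain rfl | hx := eq_or_ne s (x 0)
  swap
  · simp [hx, hx.symm]
  obtain _ | n := n
  · simp
  have h_next : ∫⁻ t, Set.indicator {x 1} 1 t ∂(N [] (x 0)).toMeasure = N [] (x 0) (x 1) := by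
    rw [lintegral_indicator_one (measurableSet_singleton _),
      PMF.toMeasure_apply_singleton _ _ (measurableSet_singleton _)]
  simp only [Set.ofPred_true, Set.univ_inter, pathMeasure_cylinder_succ]
  rw [lintegral_mul_const _ .of_discrete, h_next, Finset.prod_range_succ', mul_comm]
  simp [List.ofFn_succ]

lemma pathMeasure_apply (N : List S → S → PMF S) (s : S) {A : Set (ℕ → S)} (hA : MeasurableSet A) :
    pathMeasure N s A =
      ∫⁻ t, pathMeasure (fun w => N (s :: w)) t (pathCons s ⁻¹' A) ∂(N [] s).toMeasure := by
  let κ : Kernel S (ℕ → S) := Kernel.ofFunOfCountable fun t =>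
    (pathMeasure (fun w => N (s :: w)) t).map (pathCons s)
  have : IsMarkovKernel κ :=
    ⟨fun t => Measure.isProbabilityMeasure_map (measurable_pathCons s).aemeasurable⟩
  have hκ {B} (hB : MeasurableSet B) : (κ ∘ₘ (N [] s).toMeasure) B =
      ∫⁻ t, pathMeasure (fun w => N (s :: w)) t (pathCons s ⁻¹' B) ∂(N [] s).toMeasure := by
    rw [Measure.bind_apply hB κ.measurable.aemeasurable]
    exact lintegral_congr fun t => Measure.map_apply (measurable_pathCons s) hB
  have hcyl x n : (κ ∘ₘ (N [] s).toMeasure) (PiNat.cylinder x n) =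
      pathMeasure N s (PiNat.cylinder x n) := by
    rw [hκ (measurableSet_cylinder x n), lintegral_pathMeasure_preimage_pathCons_cylinder]
  rw [← hκ hA]
  exact le_antisymm (measure_le_of_cylinder (fun x n => (hcyl x n).ge) A)
    (measure_le_of_cylinder (fun x n => (hcyl x n).le) A)

/-- The law of the Markov chain with transition probabilities `g` that starts in `s`. -/
noncomputable def chain (g : S → PMF S) (s : S) : Measure (ℕ → S) :=
  pathMeasure (fun _ => g) s

instance (g : S → PMF S) (s : S) : IsProbabilityMeasure (chain g s) := by
  unfold chain; infer_instance

lemma chain_apply (g : S → PMF S) (s : S) {A : Set (ℕ → S)} (hA : MeasurableSet A) :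
    chain g s A = ∫⁻ t, chain g t (pathCons s ⁻¹' A) ∂(g s).toMeasure :=
  pathMeasure_apply _ s hA

lemma le_smul_chain {g : S → PMF S} {c : ℝ≥0∞} (hc : c ≠ ∞) {ρ : S → Measure (ℕ → S)}
    (hρ_univ : ∀ s, ρ s Set.univ ≤ c)
    (hρ : ∀ s B, MeasurableSet B → ρ s B ≤ ∫⁻ t, ρ t (pathCons s ⁻¹' B) ∂(g s).toMeasure) (s : S) :
    ρ s ≤ c • chain g s := by
  have hcyl (n : ℕ) (s : S) (x : ℕ → S) :
      ρ s (PiNat.cylinder x n) ≤ c * chain g s (PiNat.cylinder x n) := by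
    induction n generalizing s x with
    | zero => simpa using hρ_univ s
    | succ n ih =>
      have hm := measurableSet_cylinder x (n + 1)
      rw [chain_apply g s hm, ← lintegral_const_mul _ .of_discrete]
      refine (hρ s _ hm).trans (lintegral_mono fun t => ?_)
      rw [preimage_pathCons_cylinder_succ]
      by_cases hx : x 0 = s
      · simpa [hx] using ih t _
      · simp [hx]
  have := Measure.smul_finite (chain g s) hc
  have : IsFiniteMeasure (ρ s) := ⟨(hρ_univ s).trans_lt hc.lt_top⟩
  exact measure_le_of_cylinder fun x n => hcyl n s x

end PathMeasure

/-! ### Optimal reachability and safety -/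

section Reachability

variable {S : Type*} [MeasurableSpace S] {D E : S → Set (PMF S)} {T U H K : Set S} {s : S}
  {c β : ℝ≥0∞} {v w : S → ℝ≥0∞}

lemma eq_zero_of_le_mul_self {x : ℝ≥0∞} (hc : c < 1) (hx : x ≠ ∞) (h : x ≤ c * x) : x = 0 := by
  by_contra h0
  exact absurd h (not_le.2 (by simpa using ENNReal.mul_lt_mul_left h0 hx hc))

/-- The Bellman operator: the supremum of the expected value of `v` after one step, over the
decisions `D s` that are available in the state `s`. -/
noncomputable def bellman (D : S → Set (PMF S)) (v : S → ℝ≥0∞) (s : S) : ℝ≥0∞ :=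
  ⨆ p ∈ D s, ∫⁻ t, v t ∂p.toMeasure

lemma lintegral_le_bellman {p : PMF S} (hp : p ∈ D s) (v : S → ℝ≥0∞) :
    ∫⁻ t, v t ∂p.toMeasure ≤ bellman D v s :=
  le_iSup₂ (f := fun (p : PMF S) (_ : p ∈ D s) => ∫⁻ t, v t ∂p.toMeasure) p hp

lemma bellman_mono (hDE : D s ⊆ E s) (hvw : v ≤ w) : bellman D v s ≤ bellman E w s :=
  iSup₂_le fun _ hp => (lintegral_mono hvw).trans (lintegral_le_bellman (hDE hp) w)

lemma bellman_const_le (D : S → Set (PMF S)) (c : ℝ≥0∞) (s : S) :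
    bellman D (fun _ => c) s ≤ c :=
  iSup₂_le fun p _ => by simp

lemma bellman_singleton (g : S → PMF S) (v : S → ℝ≥0∞) (s : S) :
    bellman (fun t => {g t}) v s = ∫⁻ t, v t ∂(g s).toMeasure :=
  iSup_singleton

lemma exists_bellman_eq_lintegral (hfin : (D s).Finite) (hne : (D s).Nonempty) (v : S → ℝ≥0∞) :
    ∃ p ∈ D s, bellman D v s = ∫⁻ t, v t ∂p.toMeasure := by
  obtain ⟨p, hp, hmax⟩ := Set.exists_max_image (D s) (fun p => ∫⁻ t, v t ∂p.toMeasure) hfin hne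
  exact ⟨p, hp, (iSup₂_le hmax).antisymm (lintegral_le_bellman hp v)⟩

variable [DiscreteMeasurableSpace S]

lemma bellman_add_le (D : S → Set (PMF S)) (v w : S → ℝ≥0∞) (s : S) :
    bellman D (v + w) s ≤ bellman D v s + bellman D w s := by
  refine iSup₂_le fun p hp => ?_
  simp only [Pi.add_apply]
  rw [lintegral_add_right _ .of_discrete]
  exact add_le_add (lintegral_le_bellman hp v) (lintegral_le_bellman hp w)

lemma bellman_const_mul (D : S → Set (PMF S)) (c : ℝ≥0∞) (v : S → ℝ≥0∞) (s : S) :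
    bellman D (fun t => c * v t) s = c * bellman D v s := by
  simp only [bellman, ENNReal.mul_iSup, lintegral_const_mul _ Measurable.of_discrete]

open Classical in
/-- The supremum, over the policies that take decisions in `D`, of the probability of visiting `T`
at one of the times `0, …, n - 1`. -/
noncomputable def reachWithin (D : S → Set (PMF S)) (T : Set S) : ℕ → S → ℝ≥0∞
  | 0 => 0
  | n + 1 => T.piecewise 1 (bellman D (reachWithin D T n))

/-- The supremum, over the policies that take decisions in `D`, of the probability of visiting
`T`. -/
noncomputable def reach (D : S → Set (PMF S)) (T : Set S) (s : S) : ℝ≥0∞ :=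
  ⨆ n, reachWithin D T n s

/-- The supremum, over the policies that take decisions in `D`, of the probability of being in `H`
at all times `0, …, n - 1`. -/
noncomputable def stayWithin (D : S → Set (PMF S)) (H : Set S) : ℕ → S → ℝ≥0∞
  | 0 => 1
  | n + 1 => H.indicator (bellman D (stayWithin D H n))

/-- The limit of the optimal probabilities of staying in `H` for `n` steps. It is the supremum of
the probability of staying in `H` forever if `D` consists of finite sets. -/
noncomputable def stay (D : S → Set (PMF S)) (H : Set S) (s : S) : ℝ≥0∞ :=
  ⨅ n, stayWithin D H n s

omit [DiscreteMeasurableSpace S] in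
lemma monotone_reachWithin (D : S → Set (PMF S)) (T : Set S) : Monotone (reachWithin D T) := by
  refine monotone_nat_of_le_succ fun n => ?_
  induction n with
  | zero => exact fun _ => zero_le
  | succ n ih =>
    intro s
    by_cases hs : s ∈ T
    · simp [reachWithin, hs]
    · simpa [reachWithin, hs] using bellman_mono subset_rfl ih

lemma mul_reach_le (hT : ∀ t ∈ T, c ≤ v t) (hv : ∀ t ∉ T, bellman D v t ≤ v t) (s : S) :
    c * reach D T s ≤ v s := by
  rw [reach, ENNReal.mul_iSup]
  refine iSup_le fun n => ?_
  induction n generalizing s with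
  | zero => simp [reachWithin]
  | succ n ih =>
    by_cases hs : s ∈ T
    · simpa [reachWithin, hs] using hT s hs
    · simp only [reachWithin, hs, not_false_eq_true, Set.piecewise_eq_of_notMem]
      rw [← bellman_const_mul]
      exact (bellman_mono subset_rfl ih).trans (hv s hs)

lemma reach_le_one (D : S → Set (PMF S)) (T : Set S) (s : S) : reach D T s ≤ 1 := by
  rw [← one_mul (reach D T s)]
  exact mul_reach_le (v := fun _ => 1) (fun _ _ => le_rfl) (fun t _ => bellman_const_le D 1 t) s

omit [DiscreteMeasurableSpace S] in
lemma one_le_reach_of_mem (D : S → Set (PMF S)) (hs : s ∈ T) : 1 ≤ reach D T s :=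
  le_iSup_of_le 1 (by simp [reachWithin, hs])

lemma reach_of_mem (D : S → Set (PMF S)) (hs : s ∈ T) : reach D T s = 1 :=
  (reach_le_one D T s).antisymm (one_le_reach_of_mem D hs)

lemma bellman_reach_le (D : S → Set (PMF S)) (T : Set S) (s : S) :
    bellman D (reach D T) s ≤ reach D T s := by
  by_cases hs : s ∈ T
  · exact (bellman_mono subset_rfl (reach_le_one D T)).trans
      ((bellman_const_le D 1 s).trans (one_le_reach_of_mem D hs))
  refine iSup₂_le fun p hp => ?_
  simp only [reach]
  rw [lintegral_iSup (fun _ => .of_discrete) (monotone_reachWithin D T)]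
  refine iSup_mono' fun n => ⟨n + 1, ?_⟩
  simpa [reachWithin, hs] using lintegral_le_bellman hp (reachWithin D T n)

lemma reach_mono (hDE : D ≤ E) (hTU : T ⊆ U) : reach D T ≤ reach E U := by
  intro s
  rw [← one_mul (reach D T s)]
  exact mul_reach_le (fun t ht => one_le_reach_of_mem E (hTU ht))
    (fun t _ => (bellman_mono (hDE t) le_rfl).trans (bellman_reach_le E U t)) s

lemma reach_eq_one_mono (hTU : T ⊆ U) (h : ∀ s, reach D T s = 1) (s : S) : reach D U s = 1 :=
  (reach_le_one D U s).antisymm ((h s).ge.trans (reach_mono le_rfl hTU s))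

lemma reach_eq_one_of_le (hc0 : c ≠ 0) (hc : ∀ s, c ≤ reach D T s) (s : S) :
    reach D T s = 1 := by
  -- `reach D T - c` is a supermartingale with value `1 - c` on `T`, hence at least
  -- `(1 - c) * reach D T`; this rearranges to `c ≤ c * reach D T`.
  have hr1 := reach_le_one D T
  have hc1 : c ≤ 1 := (hc s).trans (hr1 s)
  have hct : c ≠ ∞ := ne_top_of_le_ne_top ENNReal.one_ne_top hc1
  have hsuper (t : S) : bellman D (fun r => reach D T r - c) t ≤ reach D T t - c := by
    refine iSup₂_le fun p hp => ?_
    rw [lintegral_sub .of_discrete (by simpa using hct) (.of_forall hc)]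
    simpa using tsub_le_tsub_right ((lintegral_le_bellman hp _).trans (bellman_reach_le D T t)) c
  have hmul : (1 - c) * reach D T s ≤ reach D T s - c :=
    mul_reach_le (fun t ht => by rw [reach_of_mem D ht]) (fun t _ => hsuper t) s
  have hcr : (reach D T s - c) + c ≤ (reach D T s - c) + c * reach D T s :=
    calc (reach D T s - c) + c = ((1 - c) + c) * reach D T s := by
          rw [tsub_add_cancel_of_le (hc s), tsub_add_cancel_of_le hc1, one_mul]
      _ = (1 - c) * reach D T s + c * reach D T s := add_mul ..
      _ ≤ (reach D T s - c) + c * reach D T s := by gcongr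
  have hfin : reach D T s - c ≠ ∞ :=
    ne_top_of_le_ne_top ENNReal.one_ne_top (tsub_le_self.trans (hr1 s))
  refine (hr1 s).antisymm ((ENNReal.mul_le_mul_iff_right hc0 hct).1 ?_)
  rw [mul_one]
  exact (ENNReal.add_le_add_iff_left hfin).1 hcr

lemma le_reach_of_le_mul_bellman (hβ : β < 1) (hv1 : ∀ s, v s ≤ 1)
    (hv : ∀ s ∉ T, v s ≤ β * bellman D v s) (s : S) : v s ≤ reach D T s := by
  set m := ⨆ t, (v t - reach D T t)
  have hle (t : S) : v t ≤ reach D T t + m :=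
    tsub_le_iff_left.1 (le_iSup (fun t => v t - reach D T t) t)
  have hm_le : m ≤ β * m := by
    refine iSup_le fun t => tsub_le_iff_left.2 ?_
    by_cases ht : t ∈ T
    · exact (hv1 t).trans ((one_le_reach_of_mem D ht).trans le_self_add)
    calc v t ≤ β * bellman D (reach D T + fun _ => m) t :=
          (hv t ht).trans (by gcongr; exact bellman_mono subset_rfl hle)
      _ ≤ β * (reach D T t + m) := by
          gcongr
          exact (bellman_add_le ..).trans
            (add_le_add (bellman_reach_le D T t) (bellman_const_le D m t))
      _ ≤ reach D T t + β * m := by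
          rw [mul_add]
          gcongr
          exact mul_le_of_le_one_left zero_le hβ.le
  have hm_top : m ≠ ∞ :=
    ne_top_of_le_ne_top ENNReal.one_ne_top (iSup_le fun t => tsub_le_self.trans (hv1 t))
  simpa [eq_zero_of_le_mul_self hβ hm_top hm_le] using hle s

omit [DiscreteMeasurableSpace S] in
lemma stayWithin_mono (hDE : D ≤ E) (hHK : H ⊆ K) (n : ℕ) :
    stayWithin D H n ≤ stayWithin E K n := by
  induction n with
  | zero => rfl
  | succ n ih =>
    exact (Set.indicator_mono fun s => bellman_mono (hDE s) ih).trans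
      (Set.indicator_le_indicator_of_subset hHK fun _ => zero_le)

omit [DiscreteMeasurableSpace S] in
lemma stay_mono (hDE : D ≤ E) (hHK : H ⊆ K) : stay D H ≤ stay E K :=
  fun s => iInf_mono fun n => stayWithin_mono hDE hHK n s

omit [DiscreteMeasurableSpace S] in
lemma antitone_stayWithin (D : S → Set (PMF S)) (H : Set S) : Antitone (stayWithin D H) := by
  refine antitone_nat_of_succ_le fun n => ?_
  induction n with
  | zero =>
    exact Set.indicator_le' (fun s _ => bellman_const_le D 1 s) fun _ _ => zero_le
  | succ n ih => exact Set.indicator_mono fun s => bellman_mono subset_rfl ih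

omit [DiscreteMeasurableSpace S] in
lemma stay_le_one (D : S → Set (PMF S)) (H : Set S) (s : S) : stay D H s ≤ 1 :=
  iInf_le _ 0

omit [DiscreteMeasurableSpace S] in
lemma stay_of_notMem (D : S → Set (PMF S)) (hs : s ∉ H) : stay D H s = 0 :=
  le_zero_iff.1 (iInf_le_of_le 1 (by simp [stayWithin, hs]))

lemma le_mul_stay (hct : c ≠ ∞) (hc : ∀ s, v s ≤ c) (hv : v ≤ H.indicator (bellman D v)) (s : S) :
    v s ≤ c * stay D H s := by
  rw [stay, ENNReal.mul_iInf fun h => absurd h hct]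
  refine le_iInf fun n => ?_
  induction n generalizing s with
  | zero => simpa [stayWithin] using hc s
  | succ n ih =>
    refine (hv s).trans ?_
    by_cases hs : s ∈ H
    · simpa [stayWithin, hs, bellman_const_mul] using bellman_mono (D := D) (s := s) subset_rfl ih
    · simp [hs]

lemma le_stay (hv1 : ∀ s, v s ≤ 1) (hv : v ≤ H.indicator (bellman D v)) : v ≤ stay D H :=
  fun s => by simpa using le_mul_stay ENNReal.one_ne_top hv1 hv s

lemma stay_eq_one_of_closed (hclosed : ∀ s ∈ H, ∃ p ∈ D s, p.support ⊆ H) (hs : s ∈ H) :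
    stay D H s = 1 := by
  refine (stay_le_one D H s).antisymm ?_
  have hle : H.indicator 1 ≤ stay D H := by
    refine le_stay (fun t => Set.indicator_le_self' (by simp) t)
      (Set.le_indicator (fun t ht => ?_) fun t ht => (Set.indicator_of_notMem ht 1).le)
    obtain ⟨p, hp, hpH⟩ := hclosed t ht
    refine le_trans ?_ (lintegral_le_bellman hp _)
    rw [lintegral_indicator_one .of_discrete,
      (PMF.toMeasure_apply_eq_one_iff _ .of_discrete).2 hpH]
    exact Set.indicator_le_self' (by simp) t
  simpa [hs] using hle s

lemma exists_stay_le_lintegral (hfin : (D s).Finite) (hne : (D s).Nonempty) (H : Set S) :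
    ∃ p ∈ D s, stay D H s ≤ ∫⁻ t, stay D H t ∂p.toMeasure := by
  by_contra! hlt
  have hev : ∀ᶠ n in atTop, ∀ p ∈ D s, ∫⁻ t, stayWithin D H n t ∂p.toMeasure < stay D H s := by
    refine (eventually_all_finite hfin).2 fun p hp => ?_
    have hlt := hlt p hp
    simp only [stay] at hlt
    rw [lintegral_iInf (fun _ => .of_discrete) (antitone_stayWithin D H)
      (by simp [stayWithin]), iInf_lt_iff] at hlt
    obtain ⟨n, hn⟩ := hlt
    filter_upwards [eventually_ge_atTop n] with m hm
    exact (lintegral_mono (antitone_stayWithin D H hm)).trans_lt hn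
  obtain ⟨n, hn⟩ := hev.exists
  obtain ⟨p, hp, hmax⟩ := exists_bellman_eq_lintegral hfin hne (stayWithin D H n)
  refine absurd (hn p hp) (not_lt.2 ?_)
  rw [← hmax]
  exact (iInf_le _ (n + 1)).trans (Set.indicator_le_self' (fun _ _ => zero_le) s)

lemma stay_le_indicator_bellman (hfin : ∀ s, (D s).Finite) (hne : ∀ s, (D s).Nonempty)
    (H : Set S) : stay D H ≤ H.indicator (bellman D (stay D H)) := by
  refine Set.le_indicator (fun s _ => ?_) fun s hs => (stay_of_notMem D hs).le
  obtain ⟨p, hp, hle⟩ := exists_stay_le_lintegral (hfin s) (hne s) H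
  exact hle.trans (lintegral_le_bellman hp _)

lemma stay_eq_zero_of_subset (hfin : ∀ s, (D s).Finite) (hne : ∀ s, (D s).Nonempty) (hKH : K ⊆ H)
    (hc1 : c < 1) (hc : ∀ s ∈ K, stay D H s ≤ c) (s : S) : stay D K s = 0 := by
  have hle (t : S) : stay D K t ≤ c := by
    by_cases ht : t ∈ K
    · exact (stay_mono le_rfl hKH t).trans (hc t ht)
    · simp [stay_of_notMem D ht]
  exact eq_zero_of_le_mul_self hc1 (ne_top_of_le_ne_top ENNReal.one_ne_top (stay_le_one D K s))
    (le_mul_stay hc1.ne_top hle (stay_le_indicator_bellman hfin hne K) s)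

lemma le_reach_add_stay (hv1 : ∀ s, v s ≤ 1) (hv0 : ∀ s ∉ H ∪ T, v s = 0)
    (hv : ∀ s ∈ H, v s ≤ bellman D v s) (s : S) :
    v s ≤ reach D T s + stay D (H \ T) s := by
  refine tsub_le_iff_left.1 (le_stay (v := fun t => v t - reach D T t)
    (fun t => tsub_le_self.trans (hv1 t)) (Set.le_indicator (fun t ht => ?_) fun t ht => ?_) s)
  · refine tsub_le_iff_left.2 ((hv t ht.1).trans ?_)
    calc bellman D v t ≤ bellman D (reach D T + fun r => v r - reach D T r) t :=
          bellman_mono subset_rfl fun r => le_add_tsub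
      _ ≤ reach D T t + bellman D (fun r => v r - reach D T r) t :=
          (bellman_add_le ..).trans (by gcongr; exact bellman_reach_le D T t)
  · refine (tsub_eq_zero_of_le ?_).le
    by_cases htT : t ∈ T
    · exact (hv1 t).trans (one_le_reach_of_mem D htT)
    · simp [hv0 t fun h => h.elim (fun htH => ht ⟨htH, htT⟩) htT]

end Reachability

/-! ### Memoryless policies for reachability -/

section MemorylessReachability

variable {S : Type*} {D : S → Set (PMF S)} {A T : Set S} {f : S → PMF S} {s : S} {p : PMF S}

open scoped Topology

open Classical in
/-- The restriction of the decisions `D` in which the decision `f s` is imposed in the states `s` of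
`A`. -/
noncomputable def fixOn (D : S → Set (PMF S)) (A : Set S) (f : S → PMF S) : S → Set (PMF S) :=
  A.piecewise (fun s => {f s}) D

lemma fixOn_of_mem (hs : s ∈ A) : fixOn D A f s = {f s} := by
  simp [fixOn, hs]

lemma fixOn_of_notMem (hs : s ∉ A) : fixOn D A f s = D s := by
  simp [fixOn, hs]

lemma fixOn_le (hf : ∀ s, f s ∈ D s) : fixOn D A f ≤ D := fun s => by
  by_cases hs : s ∈ A
  · simpa [fixOn_of_mem hs] using hf s
  · rw [fixOn_of_notMem hs]

lemma mem_fixOn (hf : ∀ s, f s ∈ D s) (A : Set S) (s : S) : f s ∈ fixOn D A f s := by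
  by_cases hs : s ∈ A
  · simp [fixOn_of_mem hs]
  · simpa [fixOn_of_notMem hs] using hf s

variable [MeasurableSpace S] [DiscreteMeasurableSpace S] {β c : ℝ≥0∞} {v : S → ℝ≥0∞}

lemma reach_fixOn_eq_one (hc0 : c ≠ 0) (hc1 : c ≤ 1) (hA : ∀ s ∈ A, c ≤ reach (fixOn D A f) T s)
    (h1 : ∀ s, reach D (T ∪ A) s = 1) (s : S) : reach (fixOn D A f) T s = 1 := by
  refine reach_eq_one_of_le hc0 (fun t => ?_) s
  rw [← mul_one c, ← h1 t]
  refine mul_reach_le (fun r hr => ?_) (fun r hr => ?_) t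
  · exact hr.elim (fun hT => hc1.trans (one_le_reach_of_mem _ hT)) (hA r)
  · refine (bellman_mono (fixOn_of_notMem ?_).ge le_rfl).trans (bellman_reach_le _ T r)
    exact fun hrA => hr (Or.inr hrA)

omit [DiscreteMeasurableSpace S] in
lemma tsub_le_mul_lintegral_of_mem_fixOn (hβ : β ≤ 1) (hp : p ∈ fixOn D {t | c ≤ v t} f s)
    (hf : v s ≤ β * ∫⁻ t, v t ∂(f s).toMeasure) :
    v s - c ≤ β * ∫⁻ t, (v t - c) ∂p.toMeasure := by
  by_cases hs : c ≤ v s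
  · obtain rfl : p = f s := by simpa [fixOn_of_mem (A := {t | c ≤ v t}) hs] using hp
    refine tsub_le_iff_right.2 (hf.trans ?_)
    calc β * ∫⁻ t, v t ∂(f s).toMeasure ≤ β * ∫⁻ t, (v t - c) + c ∂(f s).toMeasure := by
          gcongr
          exact le_tsub_add
      _ = β * ∫⁻ t, (v t - c) ∂(f s).toMeasure + β * c := by
          simp [lintegral_add_right, mul_add]
      _ ≤ β * ∫⁻ t, (v t - c) ∂(f s).toMeasure + c := by
          gcongr
          exact mul_le_of_le_one_left zero_le hβ
  · simp [tsub_eq_zero_of_le (not_le.1 hs).le]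

/-- Discounting: a slightly smaller lower bound on `reach D T` grows geometrically before `T`, which
prevents an optimal decision for it from postponing the visit of `T` forever. -/
lemma exists_le_mul_bellman (hc : c < reach D T s) :
    ∃ β < 1, ∃ d : S → ℝ≥0∞, (∀ t, d t ≤ 1) ∧ c ≤ d s ∧ ∀ t ∉ T, d t ≤ β * bellman D d t := by
  have hr1 (n : ℕ) (t : S) : reachWithin D T n t ≤ 1 :=
    (le_iSup (fun n => reachWithin D T n t) n).trans (reach_le_one D T t)
  obtain ⟨n, hn⟩ : ∃ n, c < reachWithin D T n s := lt_iSup_iff.1 hc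
  obtain ⟨β, hβc, hβ1⟩ : ∃ β : ℝ≥0∞, c < β ^ n * reachWithin D T n s ∧ β < 1 := by
    have hlim : Tendsto (fun β : ℝ≥0∞ => β ^ n * reachWithin D T n s) (𝓝 1)
        (𝓝 (1 ^ n * reachWithin D T n s)) :=
      ENNReal.Tendsto.mul_const (ENNReal.continuous_pow n).continuousAt
        (.inr (ne_top_of_le_ne_top ENNReal.one_ne_top (hr1 n s)))
    rw [one_pow, one_mul] at hlim
    have : (𝓝[<] (1 : ℝ≥0∞)).NeBot := nhdsLT_neBot_of_exists_lt ⟨0, by simp⟩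
    have hlt : ∀ᶠ β : ℝ≥0∞ in 𝓝[<] 1, β < 1 := eventually_mem_nhdsWithin
    exact (((hlim.eventually (lt_mem_nhds hn)).filter_mono nhdsWithin_le_nhds).and hlt).exists
  refine ⟨β, hβ1, fun t => ⨆ n, β ^ n * reachWithin D T n t,
    fun t => iSup_le fun n => mul_le_one' (pow_le_one' hβ1.le n) (hr1 n t),
    le_iSup_of_le n hβc.le, fun t ht => iSup_le fun n => ?_⟩
  cases n with
  | zero => simp [reachWithin]
  | succ n =>
    simp only [reachWithin, ht, not_false_eq_true, Set.piecewise_eq_of_notMem]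
    rw [pow_succ', mul_assoc, ← bellman_const_mul]
    gcongr
    exact bellman_mono subset_rfl fun r => le_iSup (fun n => β ^ n * reachWithin D T n r) n

/-- The restriction imposes, wherever `c ≤ d`, a decision that is optimal for the bound `d` of
`exists_le_mul_bellman`: then `d - c` still grows geometrically before `T`, whatever is decided
elsewhere. -/
lemma exists_restriction_le_reach_singleton (hfin : ∀ s, (D s).Finite) (hne : ∀ s, (D s).Nonempty)
    (h1 : ∀ s, reach D T s = 1) (hc0 : c ≠ 0) (hc1 : c + c < 1) (s : S) :
    ∃ E ≤ D, (∀ t, (E t).Nonempty) ∧ (∀ t, reach E T t = 1) ∧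
      ∀ g : S → PMF S, (∀ t, g t ∈ E t) → c ≤ reach (fun t => {g t}) T s := by
  obtain ⟨β, hβ, d, hd1, hds, hd⟩ := exists_le_mul_bellman (hc1.trans_eq (h1 s).symm)
  choose f hfD hf using fun t => exists_bellman_eq_lintegral (hfin t) (hne t) d
  set E := fixOn D {t | c ≤ d t} f
  have hfd (t : S) (ht : t ∉ T) : d t ≤ β * ∫⁻ r, d r ∂(f t).toMeasure := hf t ▸ hd t ht
  have hdE : ∀ t, d t ≤ reach E T t :=
    le_reach_of_le_mul_bellman hβ hd1 fun t ht => (hfd t ht).trans <| by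
      gcongr
      exact lintegral_le_bellman (mem_fixOn hfD _ t) d
  refine ⟨E, fixOn_le hfD, fun t => ⟨f t, mem_fixOn hfD _ t⟩, ?_, fun g hg => ?_⟩
  · exact reach_fixOn_eq_one hc0 (le_self_add.trans hc1.le) (fun t ht => le_trans ht (hdE t))
      (reach_eq_one_mono Set.subset_union_left h1)
  · have hct : c ≠ ∞ := (le_self_add.trans_lt hc1).ne_top
    calc c ≤ d s - c := ENNReal.le_sub_of_add_le_right hct hds
      _ ≤ reach (fun t => {g t}) T s :=
        le_reach_of_le_mul_bellman (v := fun t => d t - c) hβ (fun t => tsub_le_self.trans (hd1 t))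
          (fun t ht => by
            rw [bellman_singleton]
            exact tsub_le_mul_lintegral_of_mem_fixOn hβ.le (hg t) (hfd t ht)) s

lemma inv_three_add_inv_three_lt_one : (3⁻¹ + 3⁻¹ : ℝ≥0∞) < 1 := by
  rw [← ENNReal.inv_three_add_inv_three]
  exact ENNReal.lt_add_right (by simp) (by simp)

lemma exists_reach_singleton_eq_one [Countable S] (hfin : ∀ s, (D s).Finite)
    (hne : ∀ s, (D s).Nonempty) (h1 : ∀ s, reach D T s = 1) :
    ∃ g : S → PMF S, (∀ s, g s ∈ D s) ∧ ∀ s, reach (fun t => {g t}) T s = 1 := by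
  rcases isEmpty_or_nonempty S with hS | hS
  · exact ⟨isEmptyElim, isEmptyElim, isEmptyElim⟩
  obtain ⟨e, he⟩ := exists_surjective_nat S
  let Restriction := {E : S → Set (PMF S) // (∀ s, (E s).Finite) ∧ (∀ s, (E s).Nonempty) ∧
    ∀ s, reach E T s = 1}
  have hstep (E : Restriction) (s : S) : ∃ E' : Restriction, E'.1 ≤ E.1 ∧
      ∀ g : S → PMF S, (∀ t, g t ∈ E'.1 t) → 3⁻¹ ≤ reach (fun t => {g t}) T s := by
    obtain ⟨E', hsub, hne', h1', hg⟩ := exists_restriction_le_reach_singleton E.2.1 E.2.2.1 E.2.2.2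
      (c := 3⁻¹) (by simp) inv_three_add_inv_three_lt_one s
    exact ⟨⟨E', fun t => (E.2.1 t).subset (hsub t), hne', h1'⟩, hsub, hg⟩
  choose next hsub hnext using hstep
  let seq : ℕ → Restriction := fun n => Nat.rec ⟨D, hfin, hne, h1⟩ (fun n E => next E (e n)) n
  have hanti : Antitone fun n => (seq n).1 :=
    antitone_nat_of_succ_le fun n => hsub (seq n) (e n)
  have hinter (s : S) : ∃ p, ∀ n, p ∈ (seq n).1 s := by
    by_contra! hcon
    choose m hm using hcon
    obtain ⟨N, hN⟩ := ((hfin s).image m).bddAbove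
    obtain ⟨p, hp⟩ := (seq N).2.2.1 s
    have hpD : p ∈ D s := hanti (Nat.zero_le N) s hp
    exact hm p (hanti (hN ⟨p, hpD, rfl⟩) s hp)
  choose g hg using hinter
  refine ⟨g, fun s => hg s 0, reach_eq_one_of_le (c := 3⁻¹) (by simp) fun s => ?_⟩
  obtain ⟨n, rfl⟩ := he s
  exact hnext (seq n) (e n) g fun t => hg t (n + 1)

lemma exists_reach_singleton_union_stay [Countable S] {C Z : Set S} (hfin : ∀ s, (D s).Finite)
    (hne : ∀ s, (D s).Nonempty) (hc0 : c ≠ 0) (hc1 : c + c < 1)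
    (hreach : ∀ T, C ⊆ T → (∀ s, stay D (Z \ T) s = 0) → ∀ s, reach D T s = 1) :
    ∃ g : S → PMF S, (∀ s, g s ∈ D s) ∧
      ∀ s, reach (fun t => {g t}) (C ∪ {t | c ≤ stay (fun r => {g r}) Z t}) s = 1 := by
  set v := stay D Z
  set T := C ∪ {t | c + c ≤ v t}
  choose f hfD hf using fun s => exists_stay_le_lintegral (hfin s) (hne s) Z
  set E := fixOn D {t | c ≤ v t} f
  have hstay : ∀ s, stay D (Z \ T) s = 0 :=
    stay_eq_zero_of_subset hfin hne Set.sdiff_subset hc1 fun s hs =>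
      (not_le.1 fun h => hs.2 (Or.inr h)).le
  have hvE (s : S) : v s ≤ reach E T s := by
    have hle := le_reach_add_stay (D := E) (H := Z) (T := T) (stay_le_one D Z)
      (fun t ht => stay_of_notMem D fun h => ht (Or.inl h))
      (fun t _ => (hf t).trans (lintegral_le_bellman (mem_fixOn hfD _ t) _)) s
    have hzero : stay E (Z \ T) s = 0 :=
      le_zero_iff.1 ((stay_mono (fixOn_le hfD) le_rfl s).trans_eq (hstay s))
    simpa [hzero] using hle
  have hET : ∀ s, reach E T s = 1 :=
    reach_fixOn_eq_one hc0 (le_self_add.trans hc1.le) (fun t ht => le_trans ht (hvE t))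
      (reach_eq_one_mono Set.subset_union_left (hreach T Set.subset_union_left hstay))
  obtain ⟨g, hgE, hg⟩ := exists_reach_singleton_eq_one
    (fun s => (hfin s).subset (fixOn_le hfD s)) (fun s => ⟨f s, mem_fixOn hfD _ s⟩) hET
  have hstay_g : (fun t => v t - c) ≤ stay (fun r => {g r}) Z := by
    refine le_stay (fun t => tsub_le_self.trans (stay_le_one D Z t))
      (Set.le_indicator (fun t _ => ?_) fun t ht => by simp [v, stay_of_notMem D ht])
    rw [bellman_singleton]
    simpa using tsub_le_mul_lintegral_of_mem_fixOn le_rfl (hgE t) (by simpa using hf t)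
  refine ⟨g, fun s => fixOn_le hfD s (hgE s), reach_eq_one_mono ?_ hg⟩
  refine Set.union_subset_union_right _ fun t ht => le_trans ?_ (hstay_g t)
  exact ENNReal.le_sub_of_add_le_right (le_self_add.trans_lt hc1).ne_top ht

end MemorylessReachability

/-! ### Tail objectives and Markov chains -/

section TailObjective

variable {S : Type*} [MeasurableSpace S] {C H Z : Set S} {φ : Set (ℕ → S)}

/-- A measurable objective that does not depend on finite prefixes. -/
structure IsTailObjective (φ : Set (ℕ → S)) : Prop where
  measurableSet : MeasurableSet φ
  preimage_pathCons : ∀ s, pathCons s ⁻¹' φ = φ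

lemma IsTailObjective.compl (hφ : IsTailObjective φ) : IsTailObjective φᶜ where
  measurableSet := hφ.measurableSet.compl
  preimage_pathCons s := by rw [Set.preimage_compl, hφ.preimage_pathCons]

lemma IsTailObjective.union {ψ : Set (ℕ → S)} (hφ : IsTailObjective φ) (hψ : IsTailObjective ψ) :
    IsTailObjective (φ ∪ ψ) where
  measurableSet := hφ.measurableSet.union hψ.measurableSet
  preimage_pathCons s := by
    rw [Set.preimage_union, hφ.preimage_pathCons, hψ.preimage_pathCons]

omit [MeasurableSpace S] in
lemma antitone_forall_lt_mem (H : Set S) : Antitone fun n => {w : ℕ → S | ∀ i < n, w i ∈ H} :=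
  fun _ _ hmn _ hw i hi => hw i (hi.trans_le hmn)

omit [MeasurableSpace S] in
lemma iInter_forall_lt_mem (H : Set S) :
    ⋂ n, {w : ℕ → S | ∀ i < n, w i ∈ H} = {w | ∀ n, w n ∈ H} := by
  ext w
  simp only [Set.mem_iInter, Set.mem_ofPred_eq]
  exact ⟨fun h n => h (n + 1) n n.lt_succ_self, fun h _ i _ => h i⟩

variable [DiscreteMeasurableSpace S]

lemma measurableSet_forall_lt_mem (H : Set S) (n : ℕ) :
    MeasurableSet {w : ℕ → S | ∀ i < n, w i ∈ H} := by
  simp only [Set.ofPred_forall]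
  exact .iInter fun i => .iInter fun _ => measurableSet_apply_mem H i

lemma measurableSet_forall_mem (H : Set S) : MeasurableSet {w : ℕ → S | ∀ n, w n ∈ H} := by
  rw [← iInter_forall_lt_mem]
  exact .iInter (measurableSet_forall_lt_mem H)

lemma isTailObjective_frequently (C : Set S) :
    IsTailObjective {w : ℕ → S | ∃ᶠ n in atTop, w n ∈ C} where
  measurableSet := by
    simp only [frequently_atTop, Set.ofPred_forall, Set.ofPred_exists, Set.ofPred_and]
    exact .iInter fun i => .iUnion fun j => (MeasurableSet.const _).inter
      (measurableSet_apply_mem C j)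
  preimage_pathCons s := by
    ext w
    change (∃ᶠ n in atTop, pathCons s w n ∈ C) ↔ _
    conv_lhs => rw [← map_add_atTop_eq_nat 1, frequently_map]
    rfl

/-- The Streett objective with one pair: to visit `C` infinitely often or to be in `Z` from some
time on. -/
def streett (C Z : Set S) : Set (ℕ → S) :=
  {w | ∃ᶠ n in atTop, w n ∈ C} ∪ {w | ∀ᶠ n in atTop, w n ∈ Z}

lemma isTailObjective_streett (C Z : Set S) : IsTailObjective (streett C Z) := by
  have hZ : {w : ℕ → S | ∀ᶠ n in atTop, w n ∈ Z} = {w | ∃ᶠ n in atTop, w n ∈ Zᶜ}ᶜ := by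
    ext w
    simp
  rw [streett, hZ]
  exact (isTailObjective_frequently C).union (isTailObjective_frequently Zᶜ).compl

omit [MeasurableSpace S] [DiscreteMeasurableSpace S] in
lemma parity_eq_streett {col : S → ℕ} (hcol : ∀ s, col s ≤ 2) :
    parity col = streett {s | col s = 2} {s | col s = 0} := by
  ext w
  refine ⟨?_, ?_⟩
  · rintro ⟨i, hfreq, hle⟩
    obtain _ | i := i
    · exact .inr (hle.mono fun n hn => Nat.le_zero.1 hn)
    · exact .inl (hfreq.mono fun n hn => (hcol (w n)).antisymm (by lia))
  · rintro (hfreq | hev)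
    · exact ⟨1, hfreq, .of_forall fun n => hcol (w n)⟩
    · exact ⟨0, hev.frequently, hev.mono fun n hn => le_of_eq hn⟩

variable [Countable S] {A : Set (ℕ → S)} {c : ℝ≥0∞} {g : S → PMF S} {v : S → ℝ≥0∞}

lemma stay_le_chain (g : S → PMF S) (H : Set S) (s : S) :
    stay (fun t => {g t}) H s ≤ chain g s {w | ∀ n, w n ∈ H} := by
  have hwithin (n : ℕ) (s : S) :
      stayWithin (fun t => {g t}) H n s ≤ chain g s {w | ∀ i < n, w i ∈ H} := by
    induction n generalizing s with
    | zero => simp [stayWithin]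
    | succ n ih =>
      rw [chain_apply _ _ (measurableSet_forall_lt_mem H _)]
      simp only [preimage_pathCons_forall_lt_succ, stayWithin]
      by_cases hs : s ∈ H
      · simpa [hs, bellman_singleton] using lintegral_mono ih
      · simp [hs]
  rw [← iInter_forall_lt_mem, (antitone_forall_lt_mem H).measure_iInter
    (fun n => (measurableSet_forall_lt_mem H n).nullMeasurableSet) ⟨0, measure_ne_top _ _⟩]
  exact iInf_mono fun n => hwithin n s

/-- By the Markov property, `A ∩ B` is at most `c` times as likely as `B` if `B` concerns a finite
prefix only, hence for every measurable `B`. The case `B = A` gives the claim. -/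
lemma chain_eq_zero_of_le (hA : MeasurableSet A) (hpre : ∀ s, pathCons s ⁻¹' A ⊆ A) (hc1 : c < 1)
    (hc : ∀ s, chain g s A ≤ c) (s : S) : chain g s A = 0 := by
  refine eq_zero_of_le_mul_self hc1 (measure_ne_top _ _) ?_
  have hle := le_smul_chain (g := g) hc1.ne_top (ρ := fun s => (chain g s).restrict A)
    (fun t => by simpa using hc t) (fun t B hB => ?_) s A
  · simpa using hle
  · simp only [Measure.restrict_apply hB, Measure.restrict_apply (measurable_pathCons _ hB)]
    rw [chain_apply g t (hB.inter hA)]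
    exact lintegral_mono fun r => measure_mono (Set.inter_subset_inter_right _ (hpre t))

lemma lintegral_toMeasure (p : PMF S) (v : S → ℝ≥0∞) :
    ∫⁻ t, v t ∂p.toMeasure = ∑' t, v t * p t := by
  simp [lintegral_countable', PMF.toMeasure_apply_singleton]

lemma mul_chain_le {k : S → PMF S} (hv1 : ∀ s, v s ≤ 1)
    (hv : ∀ s t, v s * g s t ≤ k s t * v t) (s : S) (A : Set (ℕ → S)) :
    v s * chain g s A ≤ chain k s A := by
  have hle := le_smul_chain (g := k) ENNReal.one_ne_top (ρ := fun s => v s • chain g s)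
    (fun t => by simpa using hv1 t) (fun t B hB => ?_) s A
  · simpa using hle
  · simp only [Measure.smul_apply, smul_eq_mul, chain_apply g t hB, lintegral_toMeasure,
      ← ENNReal.tsum_mul_left]
    refine ENNReal.tsum_le_tsum fun r => ?_
    calc v t * (chain g r (pathCons t ⁻¹' B) * g t r)
        = v t * g t r * chain g r (pathCons t ⁻¹' B) := by ring
      _ ≤ k t r * v r * chain g r (pathCons t ⁻¹' B) := mul_le_mul_left (hv t r) _
      _ = v r * chain g r (pathCons t ⁻¹' B) * k t r := by ring

lemma pathMeasure_eventually_mem_inter_eq_zero (hφ : IsTailObjective φ) (H : Set S)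
    {P : (List S → S → PMF S) → S → Prop}
    (hP : ∀ N s, P N s → ∀ᵐ t ∂(N [] s).toMeasure, P (fun w => N (s :: w)) t)
    (h0 : ∀ N s, P N s → pathMeasure N s ({w | ∀ n, w n ∈ H} ∩ φ) = 0)
    {N : List S → S → PMF S} {s : S} (hN : P N s) :
    pathMeasure N s ({w | ∀ᶠ n in atTop, w n ∈ H} ∩ φ) = 0 := by
  have hshift (m : ℕ) : pathMeasure N s ({w | ∀ n, w (n + m) ∈ H} ∩ φ) = 0 := by
    induction m generalizing N s with
    | zero => exact h0 N s hN
    | succ m ih =>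
      have hmeas : MeasurableSet {w : ℕ → S | ∀ n, w (n + (m + 1)) ∈ H} := by
        simp only [Set.ofPred_forall]
        exact .iInter fun n => measurableSet_apply_mem H _
      rw [pathMeasure_apply N s (hmeas.inter hφ.measurableSet), Set.preimage_inter,
        hφ.preimage_pathCons]
      exact (lintegral_congr_ae ((hP N s hN).mono fun t ht => ih ht)).trans lintegral_zero
  refine measure_mono_null (fun w hw => ?_) (measure_iUnion_null hshift)
  obtain ⟨m, hm⟩ := eventually_atTop.1 hw.1
  exact Set.mem_iUnion.2 ⟨m, fun n => hm _ le_add_self, hw.2⟩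

lemma chain_streett_eq_one (hc0 : c ≠ 0) (hc1 : c ≤ 1)
    (hg : ∀ s, reach (fun t => {g t}) (C ∪ {t | c ≤ stay (fun r => {g r}) Z t}) s = 1) (s : S) :
    chain g s (streett C Z) = 1 := by
  have hφ := isTailObjective_streett C Z
  set A : Set (ℕ → S) := {w | ∀ n, w n ∈ Cᶜ} ∩ (streett C Z)ᶜ
  have hA : MeasurableSet A := (measurableSet_forall_mem _).inter hφ.measurableSet.compl
  have hpre (t : S) : pathCons t ⁻¹' A ⊆ A :=
    Set.inter_subset_inter (fun w hw n => hw (n + 1)) (hφ.compl.preimage_pathCons t).subset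
  have hbound (t : S) : c ≤ chain g t Aᶜ := by
    rw [← mul_one c, ← hg t]
    refine mul_reach_le (v := fun r => chain g r Aᶜ) (fun r hr => ?_) (fun r _ => ?_) t
    · rcases hr with hr | hr
      · rw [chain_apply g r hA.compl]
        have huniv : pathCons r ⁻¹' Aᶜ = Set.univ :=
          Set.eq_univ_of_forall fun w hw => hw.1 0 hr
        simpa [huniv] using hc1
      · refine le_trans hr ((stay_le_chain g Z r).trans (measure_mono fun w hw hwA => hwA.2 ?_))
        exact .inr (.of_forall hw)
    · rw [bellman_singleton, chain_apply g r hA.compl]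
      exact lintegral_mono fun q => measure_mono (Set.compl_subset_compl.2 (hpre r))
  have hA0 : ∀ t, chain g t A = 0 :=
    chain_eq_zero_of_le hA hpre (ENNReal.sub_lt_self ENNReal.one_ne_top one_ne_zero hc0)
      fun t => by
        rw [← prob_add_prob_compl (μ := chain g t) hA]
        exact ENNReal.le_sub_of_add_le_right (ne_top_of_le_ne_top ENNReal.one_ne_top hc1)
          (by gcongr; exact hbound t)
  have hcompl : chain g s ({w | ∀ᶠ n in atTop, w n ∈ Cᶜ} ∩ (streett C Z)ᶜ) = 0 :=
    pathMeasure_eventually_mem_inter_eq_zero hφ.compl Cᶜ (P := fun N _ => N = fun _ => g)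
      (by rintro _ t rfl; exact .of_forall fun _ => rfl) (by rintro _ t rfl; exact hA0 t) rfl
  have hsub : (streett C Z)ᶜ ⊆ {w | ∀ᶠ n in atTop, w n ∈ Cᶜ} ∩ (streett C Z)ᶜ :=
    fun w hw => ⟨not_frequently.1 fun h => hw (.inl h), hw⟩
  exact (prob_compl_eq_zero_iff hφ.measurableSet).1 (measure_mono_null hsub hcompl)

end TailObjective

/-! ### Values and optimal strategies -/

section Value

variable {S : Type*} {M : MDP S} {s t : S} {p q : PMF S}

open Classical in
/-- The extreme one-step behaviours of `M`: the Dirac distributions at the successors of a player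
state, and the given distribution at a random state. -/
def choices (M : MDP S) (s : S) : Set (PMF S) :=
  if h : s ∈ M.player then PMF.pure '' {t | M.step s t} else {M.prob ⟨s, h⟩}

lemma choices_of_mem (hs : s ∈ M.player) : M.choices s = PMF.pure '' {t | M.step s t} := by
  simp [choices, hs]

lemma choices_of_notMem (hs : s ∉ M.player) : M.choices s = {M.prob ⟨s, hs⟩} := by
  simp [choices, hs]

lemma finite_choices (hM : ∀ s ∈ M.player, {t | M.step s t}.Finite) (s : S) :
    (M.choices s).Finite := by
  by_cases hs : s ∈ M.player
  · simpa only [choices_of_mem hs] using (hM s hs).image PMF.pure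
  · simp [choices_of_notMem hs]

lemma nonempty_choices (M : MDP S) (s : S) : (M.choices s).Nonempty := by
  by_cases hs : s ∈ M.player
  · rw [choices_of_mem hs]
    have hstep : {t | M.step s t}.Nonempty := M.exists_step s
    exact hstep.image PMF.pure
  · simp [choices_of_notMem hs]

namespace Strategy

/-- The behaviour of a strategy after the first state `s`. -/
def residual (σ : M.Strategy) (s : S) : M.Strategy where
  choice w := σ.choice (s :: w)
  step_of_mem_support w := σ.step_of_mem_support (s :: w)

/-- The strategy that makes its first choice according to `σ` and then continues according to `θ t`,
where `t` is the second state. -/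
noncomputable def glue (σ : M.Strategy) (θ : S → M.Strategy) : M.Strategy where
  choice
    | [], s => σ.choice [] s
    | [_], t => (θ t).choice [] t
    | _ :: t :: w, r => (θ t).choice (t :: w) r
  step_of_mem_support
    | [], s => σ.step_of_mem_support [] s
    | [_], t => (θ t).step_of_mem_support [] t
    | _ :: t :: w, r => (θ t).step_of_mem_support (t :: w) r

lemma next_of_mem (σ : M.Strategy) (w : List S) (hs : s ∈ M.player) :
    σ.next w s = σ.choice w ⟨s, hs⟩ := by
  simp [next, hs]

lemma next_of_notMem (σ : M.Strategy) (w : List S) (hs : s ∉ M.player) :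
    σ.next w s = M.prob ⟨s, hs⟩ := by
  simp [next, hs]

end Strategy

lemma exists_isMD_next_eq {k : S → PMF S} (hk : ∀ s, k s ∈ M.choices s) :
    ∃ σ : M.Strategy, σ.IsMD ∧ ∀ w, σ.next w = k := by
  have hsucc (s : {s : S // s ∈ M.player}) : ∃ t, M.step s t ∧ PMF.pure t = k s := by
    simpa [choices_of_mem s.2] using hk s
  choose f hf hfk using hsucc
  refine ⟨⟨fun _ s => PMF.pure (f s), fun _ s t ht => ?_⟩, ⟨f, fun _ _ => rfl⟩, fun w => ?_⟩
  · rw [PMF.support_pure, Set.mem_singleton_iff] at ht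
    exact ht ▸ hf s
  · ext1 s
    by_cases hs : s ∈ M.player
    · rw [Strategy.next_of_mem _ _ hs]
      exact hfk ⟨s, hs⟩
    · rw [Strategy.next_of_notMem _ _ hs]
      simpa [choices_of_notMem hs, eq_comm] using hk s

lemma exists_next_eq (hp : p ∈ M.choices s) : ∃ σ : M.Strategy, ∀ w, σ.next w s = p := by
  classical
  choose k hk using M.nonempty_choices
  obtain ⟨σ, -, hσ⟩ := exists_isMD_next_eq (M := M) (k := Function.update k s p) fun t => by
    by_cases h : t = s
    · subst h
      simpa using hp
    · simpa [h] using hk t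
  exact ⟨σ, fun w => by simp [hσ]⟩

variable [MeasurableSpace S] [DiscreteMeasurableSpace S] [Countable S]

lemma ae_toMeasure_iff {P : S → Prop} : (∀ᵐ t ∂p.toMeasure, P t) ↔ ∀ t ∈ p.support, P t := by
  simp [ae_iff_of_countable, PMF.toMeasure_apply_singleton]

namespace Strategy

instance (σ : M.Strategy) (s : S) : IsProbabilityMeasure (σ.playMeasure s) :=
  inferInstanceAs (IsProbabilityMeasure (pathMeasure σ.next s))

lemma playMeasure_apply (σ : M.Strategy) (s : S) {A : Set (ℕ → S)} (hA : MeasurableSet A) :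
    σ.playMeasure s A =
      ∫⁻ t, (σ.residual s).playMeasure t (pathCons s ⁻¹' A) ∂(σ.next [] s).toMeasure :=
  pathMeasure_apply σ.next s hA

lemma playMeasure_residual_glue (σ : M.Strategy) (θ : S → M.Strategy) (s t : S) :
    ((σ.glue θ).residual s).playMeasure t = (θ t).playMeasure t := by
  ext A hA
  rw [playMeasure_apply _ _ hA, playMeasure_apply _ _ hA]
  rfl

end Strategy

open Strategy

variable {σ : M.Strategy} {φ : Set (ℕ → S)}

lemma playMeasure_le_value (σ : M.Strategy) (φ : Set (ℕ → S)) (s : S) :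
    σ.playMeasure s φ ≤ M.value φ s :=
  le_iSup (fun σ : M.Strategy => σ.playMeasure s φ) σ

lemma value_le_one (M : MDP S) (φ : Set (ℕ → S)) (s : S) : M.value φ s ≤ 1 :=
  iSup_le fun _ => prob_le_one

lemma value_ne_top (M : MDP S) (φ : Set (ℕ → S)) (s : S) : M.value φ s ≠ ∞ :=
  ne_top_of_le_ne_top ENNReal.one_ne_top (value_le_one M φ s)

lemma exists_value_le_playMeasure_add (M : MDP S) (φ : Set (ℕ → S)) (s : S) {ε : ℝ≥0∞}
    (hε : ε ≠ 0) : ∃ σ : M.Strategy, M.value φ s ≤ σ.playMeasure s φ + ε := by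
  obtain h0 | h0 := eq_or_ne (M.value φ s) 0
  · choose k hk using M.nonempty_choices
    obtain ⟨σ, -⟩ := exists_isMD_next_eq hk
    exact ⟨σ, by simp [h0]⟩
  · obtain ⟨σ, hσ⟩ := lt_iSup_iff.1 (ENNReal.sub_lt_self (value_ne_top M φ s) h0 hε)
    exact ⟨σ, tsub_le_iff_right.1 hσ.le⟩

namespace IsTailObjective

variable (hφ : IsTailObjective φ)
include hφ

lemma playMeasure_eq (σ : M.Strategy) (s : S) :
    σ.playMeasure s φ = ∫⁻ t, (σ.residual s).playMeasure t φ ∂(σ.next [] s).toMeasure := by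
  rw [playMeasure_apply σ s hφ.measurableSet, hφ.preimage_pathCons]

lemma lintegral_value_le (σ : M.Strategy) (s : S) :
    ∫⁻ t, M.value φ t ∂(σ.next [] s).toMeasure ≤ M.value φ s := by
  refine ENNReal.le_of_forall_pos_le_add fun ε hε _ => ?_
  choose θ hθ using fun t =>
    exists_value_le_playMeasure_add M φ t (ENNReal.coe_ne_zero.2 hε.ne')
  calc ∫⁻ t, M.value φ t ∂(σ.next [] s).toMeasure
      ≤ ∫⁻ t, (θ t).playMeasure t φ + ε ∂(σ.next [] s).toMeasure := lintegral_mono hθ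
    _ = ∫⁻ t, (θ t).playMeasure t φ ∂(σ.next [] s).toMeasure + ε := by
        simp [lintegral_add_right]
    _ = (σ.glue θ).playMeasure s φ + ε := by
        simp only [hφ.playMeasure_eq (σ.glue θ), playMeasure_residual_glue]
        rfl
    _ ≤ M.value φ s + ε := by gcongr; exact playMeasure_le_value _ φ s

lemma value_le_of_step (hs : s ∈ M.player) (hst : M.step s t) : M.value φ t ≤ M.value φ s := by
  obtain ⟨σ, hσ⟩ := exists_next_eq (M := M) (s := s) (p := PMF.pure t)
    (by rw [choices_of_mem hs]; exact ⟨t, hst, rfl⟩)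
  simpa [hσ, PMF.toMeasure_pure] using hφ.lintegral_value_le σ s

end IsTailObjective

namespace Strategy.IsOptimalFrom

variable (hσ : σ.IsOptimalFrom φ s) (hφ : IsTailObjective φ)
include hσ hφ

lemma lintegral_value : ∫⁻ t, M.value φ t ∂(σ.next [] s).toMeasure = M.value φ s := by
  refine (hφ.lintegral_value_le σ s).antisymm (le_trans hσ ?_)
  rw [hφ.playMeasure_eq]
  exact lintegral_mono fun t => playMeasure_le_value _ φ t

lemma ae_residual : ∀ᵐ t ∂(σ.next [] s).toMeasure, (σ.residual s).IsOptimalFrom φ t := by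
  have hae := ae_eq_of_ae_le_of_lintegral_le (μ := (σ.next [] s).toMeasure)
    (f := fun t => (σ.residual s).playMeasure t φ) (g := M.value φ)
    (.of_forall fun t => playMeasure_le_value _ φ t)
    (by rw [← hφ.playMeasure_eq]; exact measure_ne_top _ _)
    Measurable.of_discrete.aemeasurable
    (by rw [← hφ.playMeasure_eq, hσ.lintegral_value hφ]; exact hσ)
  exact hae.mono fun t ht => ht.ge

lemma ae_value_eq (hs : s ∈ M.player) :
    ∀ᵐ t ∂(σ.next [] s).toMeasure, M.value φ t = M.value φ s := by
  refine ae_eq_of_ae_le_of_lintegral_le (ae_toMeasure_iff.2 fun t ht => ?_)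
    (by rw [hσ.lintegral_value hφ]; exact value_ne_top M φ s)
    Measurable.of_discrete.aemeasurable (by simp [hσ.lintegral_value hφ])
  rw [next_of_mem σ [] hs] at ht
  exact hφ.value_le_of_step hs (σ.step_of_mem_support _ _ t ht)

end Strategy.IsOptimalFrom

end Value

/-! ### Decisions that keep the value -/

section Doob

variable {S : Type*} {D : S → Set (PMF S)} {v : S → ℝ≥0∞} {s t : S} {p q : PMF S}

open Classical in
/-- Doob's `h`-transform, with `v` in the role of `h`, of the decisions `D`: each `p ∈ D s` under
which the expectation of `v` after one step equals `v s` is reweighted by `v`. The states in which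
`v` vanishes are made absorbing. -/
def doobTransform (D : S → Set (PMF S)) (v : S → ℝ≥0∞) (s : S) : Set (PMF S) :=
  if v s = 0 then {PMF.pure s} else {q | ∃ p ∈ D s, ∀ t, v s * q t = p t * v t}

lemma doobTransform_of_eq_zero (D : S → Set (PMF S)) (hs : v s = 0) :
    doobTransform D v s = {PMF.pure s} :=
  if_pos hs

lemma mem_doobTransform (hs : v s ≠ 0) :
    q ∈ doobTransform D v s ↔ ∃ p ∈ D s, ∀ t, v s * q t = p t * v t := by
  simp [doobTransform, hs]

lemma finite_doobTransform (hD : (D s).Finite) (hv : v s ≠ ∞) : (doobTransform D v s).Finite := by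
  by_cases hs : v s = 0
  · simp [doobTransform_of_eq_zero D hs]
  refine (hD.biUnion (t := fun p => {q : PMF S | ∀ t, v s * q t = p t * v t}) fun p _ =>
    Set.Subsingleton.finite fun q hq r hr => ?_).subset fun q hq => ?_
  · ext t
    exact (ENNReal.mul_right_inj hs hv).1 ((hq t).trans (hr t).symm)
  · simpa using (mem_doobTransform hs).1 hq

lemma ne_zero_of_mem_support_doobTransform (hs : v s ≠ 0) (hq : q ∈ doobTransform D v s)
    (ht : t ∈ q.support) : v t ≠ 0 := by
  obtain ⟨p, -, hp⟩ := (mem_doobTransform hs).1 hq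
  exact right_ne_zero_of_mul (hp t ▸ mul_ne_zero hs ht)

variable [MeasurableSpace S] [DiscreteMeasurableSpace S] [Countable S]

lemma exists_pmf_lintegral_mul_eq (h0 : ∫⁻ t, v t ∂p.toMeasure ≠ 0)
    (htop : ∫⁻ t, v t ∂p.toMeasure ≠ ∞) :
    ∃ q : PMF S, ∀ t, (∫⁻ t, v t ∂p.toMeasure) * q t = p t * v t := by
  rw [lintegral_toMeasure] at h0 htop ⊢
  refine ⟨PMF.normalize (fun t => v t * p t) h0 htop, fun t => ?_⟩
  rw [PMF.normalize_apply, mul_comm, mul_assoc, ENNReal.inv_mul_cancel h0 htop, mul_one, mul_comm]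

lemma lintegral_mul_le_bellman_doobTransform (hp : p ∈ D s) (hv : ∫⁻ t, v t ∂p.toMeasure = v s)
    (hs : v s ≠ ∞) (h : S → ℝ≥0∞) :
    ∫⁻ t, v t * h t ∂p.toMeasure ≤ v s * bellman (doobTransform D v) h s := by
  obtain h0 | h0 := eq_or_ne (v s) 0
  · have hae : ∀ᵐ t ∂p.toMeasure, v t = 0 := (lintegral_eq_zero_iff .of_discrete).1 (hv.trans h0)
    simp [lintegral_congr_ae (hae.mono fun t ht => show v t * h t = 0 by rw [ht, zero_mul])]
  obtain ⟨q, hq⟩ := exists_pmf_lintegral_mul_eq (hv.trans_ne h0) (hv.trans_ne hs)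
  rw [hv] at hq
  calc ∫⁻ t, v t * h t ∂p.toMeasure = v s * ∫⁻ t, h t ∂q.toMeasure := by
        simp only [lintegral_toMeasure, ← ENNReal.tsum_mul_left]
        refine tsum_congr fun t => ?_
        rw [mul_right_comm, mul_comm (v t), ← hq t, mul_right_comm, mul_assoc]
    _ ≤ v s * bellman (doobTransform D v) h s := by
        gcongr
        exact lintegral_le_bellman ((mem_doobTransform h0).2 ⟨p, hp, hq⟩) h

variable {M : MDP S} {φ : Set (ℕ → S)} {σ : M.Strategy} {T H C Z : Set S}

/-- The value at the states from which some strategy is optimal, and `0` elsewhere. -/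
noncomputable def optimalValue (M : MDP S) (φ : Set (ℕ → S)) : S → ℝ≥0∞ :=
  Set.indicator {s | ∃ σ : M.Strategy, σ.IsOptimalFrom φ s} (M.value φ)

/-- The Doob transform of the one-step behaviours of `M` along `optimalValue`: in a player state,
to move to a successor with the same `optimalValue`, and in a random state, to follow the given
distribution reweighted by `optimalValue`, unless this value is `0`. -/
def optimalDecisions (M : MDP S) (φ : Set (ℕ → S)) : S → Set (PMF S) :=
  doobTransform M.choices (M.optimalValue φ)

lemma optimalValue_le_one (M : MDP S) (φ : Set (ℕ → S)) (s : S) : M.optimalValue φ s ≤ 1 :=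
  (Set.indicator_le_self' (fun _ _ => zero_le) s).trans (value_le_one M φ s)

lemma optimalValue_ne_top (M : MDP S) (φ : Set (ℕ → S)) (s : S) : M.optimalValue φ s ≠ ∞ :=
  ne_top_of_le_ne_top ENNReal.one_ne_top (optimalValue_le_one M φ s)

namespace Strategy.IsOptimalFrom

variable (hσ : σ.IsOptimalFrom φ s)
include hσ

lemma optimalValue_eq : M.optimalValue φ s = M.value φ s :=
  Set.indicator_of_mem (s := {s | ∃ σ : M.Strategy, σ.IsOptimalFrom φ s}) ⟨σ, hσ⟩ _

lemma playMeasure_inter_le (A : Set (ℕ → S)) : σ.playMeasure s (φ ∩ A) ≤ M.optimalValue φ s :=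
  (measure_mono Set.inter_subset_left).trans
    (hσ.optimalValue_eq ▸ playMeasure_le_value σ φ s)

variable (hφ : IsTailObjective φ)
include hφ

lemma lintegral_optimalValue :
    ∫⁻ t, M.optimalValue φ t ∂(σ.next [] s).toMeasure = M.optimalValue φ s := by
  rw [hσ.optimalValue_eq, ← hσ.lintegral_value hφ]
  exact lintegral_congr_ae ((hσ.ae_residual hφ).mono fun t ht => ht.optimalValue_eq)

lemma lintegral_optimalValue_mul_le (h : S → ℝ≥0∞) :
    ∫⁻ t, M.optimalValue φ t * h t ∂(σ.next [] s).toMeasure ≤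
      M.optimalValue φ s * bellman (M.optimalDecisions φ) h s := by
  by_cases hs : s ∈ M.player
  · have hle : ∀ᵐ t ∂(σ.next [] s).toMeasure, M.optimalValue φ t * h t ≤
        M.optimalValue φ s * bellman (M.optimalDecisions φ) h s := by
      have hstep : ∀ᵐ t ∂(σ.next [] s).toMeasure, M.step s t := by
        rw [next_of_mem σ [] hs]
        exact ae_toMeasure_iff.2 (σ.step_of_mem_support [] ⟨s, hs⟩)
      filter_upwards [hstep, hσ.ae_residual hφ, hσ.ae_value_eq hφ hs] with t hst ht hv
      have hpure : PMF.pure t ∈ M.choices s := by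
        rw [choices_of_mem hs]
        exact ⟨t, hst, rfl⟩
      simpa [PMF.toMeasure_pure, optimalDecisions] using
        lintegral_mul_le_bellman_doobTransform hpure
        (by simp [PMF.toMeasure_pure, ht.optimalValue_eq, hσ.optimalValue_eq, hv])
        (optimalValue_ne_top M φ s) h
    simpa using lintegral_mono_ae hle
  · exact lintegral_mul_le_bellman_doobTransform
      (by rw [choices_of_notMem hs, next_of_notMem σ [] hs]; rfl)
      (hσ.lintegral_optimalValue hφ) (optimalValue_ne_top M φ s) h

lemma playMeasure_inter_exists_lt_mem_le (T : Set S) (n : ℕ) :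
    σ.playMeasure s (φ ∩ {w | ∃ i < n, w i ∈ T}) ≤
      M.optimalValue φ s * reachWithin (M.optimalDecisions φ) T n s := by
  induction n generalizing s σ with
  | zero => simp
  | succ n ih =>
    by_cases hs : s ∈ T
    · simpa [reachWithin, hs] using hσ.playMeasure_inter_le _
    have hmeas : MeasurableSet {w : ℕ → S | ∃ i < n + 1, w i ∈ T} := by
      simp only [Set.ofPred_exists, Set.ofPred_and]
      exact .iUnion fun i => (MeasurableSet.const _).inter (measurableSet_apply_mem T i)
    rw [playMeasure_apply σ s (hφ.measurableSet.inter hmeas), Set.preimage_inter,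
      hφ.preimage_pathCons, preimage_pathCons_exists_lt_succ]
    simp only [hs, Set.ofPred_false, Set.empty_union, reachWithin, not_false_eq_true,
      Set.piecewise_eq_of_notMem]
    exact (lintegral_mono_ae ((hσ.ae_residual hφ).mono fun t ht => ih ht)).trans
      (hσ.lintegral_optimalValue_mul_le hφ _)

lemma playMeasure_inter_forall_lt_mem_le (H : Set S) (n : ℕ) :
    σ.playMeasure s (φ ∩ {w | ∀ i < n, w i ∈ H}) ≤
      M.optimalValue φ s * stayWithin (M.optimalDecisions φ) H n s := by
  induction n generalizing s σ with
  | zero => simpa [stayWithin] using hσ.playMeasure_inter_le Set.univ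
  | succ n ih =>
    rw [playMeasure_apply σ s (hφ.measurableSet.inter (measurableSet_forall_lt_mem H _)),
      Set.preimage_inter, hφ.preimage_pathCons, preimage_pathCons_forall_lt_succ]
    by_cases hs : s ∈ H
    · simp only [hs, Set.ofPred_true, Set.univ_inter, stayWithin, Set.indicator_of_mem]
      exact (lintegral_mono_ae ((hσ.ae_residual hφ).mono fun t ht => ih ht)).trans
        (hσ.lintegral_optimalValue_mul_le hφ _)
    · simp [hs]

lemma playMeasure_inter_exists_mem_le (T : Set S) :
    σ.playMeasure s (φ ∩ {w | ∃ n, w n ∈ T}) ≤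
      M.optimalValue φ s * reach (M.optimalDecisions φ) T s := by
  have hmono : Monotone fun n => φ ∩ {w : ℕ → S | ∃ i < n, w i ∈ T} := fun m n hmn =>
    Set.inter_subset_inter_right φ fun w ⟨i, hi, hw⟩ => ⟨i, hi.trans_le hmn, hw⟩
  have hunion : φ ∩ {w | ∃ n, w n ∈ T} ⊆ ⋃ n, φ ∩ {w : ℕ → S | ∃ i < n, w i ∈ T} :=
    fun w ⟨hw, n, hn⟩ => Set.mem_iUnion.2 ⟨n + 1, hw, n, n.lt_succ_self, hn⟩
  calc σ.playMeasure s (φ ∩ {w | ∃ n, w n ∈ T})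
      ≤ ⨆ n, σ.playMeasure s (φ ∩ {w | ∃ i < n, w i ∈ T}) :=
        (measure_mono hunion).trans_eq hmono.measure_iUnion
    _ ≤ M.optimalValue φ s * reach (M.optimalDecisions φ) T s := by
        rw [reach, ENNReal.mul_iSup]
        exact iSup_mono (hσ.playMeasure_inter_exists_lt_mem_le hφ T)

lemma playMeasure_inter_forall_mem_le (H : Set S) :
    σ.playMeasure s (φ ∩ {w | ∀ n, w n ∈ H}) ≤
      M.optimalValue φ s * stay (M.optimalDecisions φ) H s := by
  rw [stay, ENNReal.mul_iInf fun h => absurd h (optimalValue_ne_top M φ s)]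
  refine le_iInf fun n => le_trans (measure_mono ?_) (hσ.playMeasure_inter_forall_lt_mem_le hφ H n)
  exact Set.inter_subset_inter_right φ fun w hw i _ => hw i

lemma playMeasure_eventually_mem_inter_eq_zero
    (hH : ∀ s, stay (M.optimalDecisions φ) H s = 0) :
    σ.playMeasure s ({w | ∀ᶠ n in atTop, w n ∈ H} ∩ φ) = 0 := by
  refine pathMeasure_eventually_mem_inter_eq_zero hφ H
    (P := fun N s => ∃ τ : M.Strategy, τ.IsOptimalFrom φ s ∧ N = τ.next) ?_ ?_ ⟨σ, hσ, rfl⟩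
  · rintro _ t ⟨τ, hτ, rfl⟩
    exact (hτ.ae_residual hφ).mono fun r hr => ⟨τ.residual t, hr, rfl⟩
  · rintro _ t ⟨τ, hτ, rfl⟩
    rw [Set.inter_comm, ← le_zero_iff]
    exact (hτ.playMeasure_inter_forall_mem_le hφ H).trans_eq (by rw [hH, mul_zero])

end Strategy.IsOptimalFrom

lemma finite_optimalDecisions (hM : ∀ s ∈ M.player, {t | M.step s t}.Finite) (φ : Set (ℕ → S))
    (s : S) : (M.optimalDecisions φ s).Finite :=
  finite_doobTransform (finite_choices hM s) (optimalValue_ne_top M φ s)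

lemma nonempty_optimalDecisions (hφ : IsTailObjective φ) (s : S) :
    (M.optimalDecisions φ s).Nonempty := by
  obtain h0 | h0 := eq_or_ne (M.optimalValue φ s) 0
  · simp [optimalDecisions, doobTransform_of_eq_zero _ h0]
  obtain ⟨τ, hτ⟩ := Set.mem_of_indicator_ne_zero h0
  refine Set.nonempty_iff_ne_empty.2 fun hempty => h0 ?_
  simpa [hτ.lintegral_optimalValue hφ, bellman, hempty] using
    hτ.lintegral_optimalValue_mul_le hφ 1

lemma reach_optimalDecisions_eq_one (hCT : C ⊆ T)
    (hstay : ∀ s, stay (M.optimalDecisions (streett C Z))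
      ((Z ∪ {t | M.optimalValue (streett C Z) t = 0}) \ T) s = 0) (s : S) :
    reach (M.optimalDecisions (streett C Z)) T s = 1 := by
  set φ := streett C Z
  set H := (Z ∪ {t | M.optimalValue φ t = 0}) \ T
  have hφ : IsTailObjective φ := isTailObjective_streett C Z
  obtain h0 | h0 := eq_or_ne (M.optimalValue φ s) 0
  · refine reach_of_mem _ (by_contra fun hsT => ?_)
    have hone : stay (M.optimalDecisions φ) {s} s = 1 := stay_eq_one_of_closed
      (by simp [optimalDecisions, doobTransform_of_eq_zero _ h0]) rfl
    have hsH : {s} ⊆ H := Set.singleton_subset_iff.2 ⟨.inr h0, hsT⟩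
    have hle := stay_mono (le_refl (M.optimalDecisions φ)) hsH s
    simp [hone, hstay s] at hle
  obtain ⟨τ, hτ⟩ := Set.mem_of_indicator_ne_zero h0
  have hsub : φ ⊆ (φ ∩ {w | ∃ n, w n ∈ T}) ∪ ({w | ∀ᶠ n in atTop, w n ∈ H} ∩ φ) := by
    refine fun w hw => or_iff_not_imp_left.2 fun hT => ⟨?_, hw⟩
    have hnT (n : ℕ) : w n ∉ T := fun hn => hT ⟨hw, n, hn⟩
    obtain hC | hZ := hw
    · obtain ⟨n, hn⟩ := hC.exists
      exact absurd (hCT hn) (hnT n)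
    · exact hZ.mono fun n hn => ⟨.inl hn, hnT n⟩
  have hle : M.optimalValue φ s * 1 ≤ M.optimalValue φ s * reach (M.optimalDecisions φ) T s :=
    calc M.optimalValue φ s * 1 ≤ τ.playMeasure s φ := by
          rw [mul_one, hτ.optimalValue_eq]
          exact hτ
      _ ≤ τ.playMeasure s (φ ∩ {w | ∃ n, w n ∈ T}) := by
          refine (measure_mono hsub).trans ((measure_union_le _ _).trans_eq ?_)
          rw [hτ.playMeasure_eventually_mem_inter_eq_zero hφ hstay, add_zero]
      _ ≤ M.optimalValue φ s * reach (M.optimalDecisions φ) T s :=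
          hτ.playMeasure_inter_exists_mem_le hφ T
  exact (reach_le_one _ T s).antisymm
    ((ENNReal.mul_le_mul_iff_right h0 (optimalValue_ne_top M φ s)).1 hle)

lemma exists_chain_streett_eq_one (hM : ∀ s ∈ M.player, {t | M.step s t}.Finite) (C Z : Set S) :
    ∃ g : S → PMF S, (∀ s, g s ∈ M.optimalDecisions (streett C Z) s) ∧
      ∀ s, M.optimalValue (streett C Z) s ≠ 0 → chain g s (streett C Z) = 1 := by
  set v := M.optimalValue (streett C Z)
  obtain ⟨g, hg, hreach⟩ := exists_reach_singleton_union_stay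
    (finite_optimalDecisions hM (streett C Z))
    (nonempty_optimalDecisions (isTailObjective_streett C Z)) (ENNReal.inv_ne_zero.2 (by simp))
    inv_three_add_inv_three_lt_one fun T hCT hstay => reach_optimalDecisions_eq_one hCT hstay
  refine ⟨g, hg, fun s hs => ?_⟩
  have hwin : chain g s (streett C (Z ∪ {t | v t = 0})) = 1 :=
    chain_streett_eq_one (ENNReal.inv_ne_zero.2 (by simp)) (by simp) hreach s
  have hsupp : chain g s {w | ∀ n, w n ∈ {t | v t ≠ 0}} = 1 := by
    refine prob_le_one.antisymm (le_of_eq_of_le ?_ (stay_le_chain g _ s))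
    exact (stay_eq_one_of_closed (H := {t | v t ≠ 0}) (fun t ht => ⟨g t, Set.mem_singleton _,
      fun r hr => ne_zero_of_mem_support_doobTransform ht (hg t) hr⟩) hs).symm
  refine (mem_ae_iff_prob_eq_one (isTailObjective_streett C Z).measurableSet).1 ?_
  filter_upwards [(mem_ae_iff_prob_eq_one (isTailObjective_streett C _).measurableSet).2 hwin,
    (mem_ae_iff_prob_eq_one (measurableSet_forall_mem _)).2 hsupp] with w hw hw0
  exact hw.imp_right fun hZ => hZ.mono fun n hn => hn.resolve_right (hw0 n)

theorem exists_isMD_isOptimalFrom_streett (hM : ∀ s ∈ M.player, {t | M.step s t}.Finite)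
    (C Z : Set S) :
    ∃ σ : M.Strategy, σ.IsMD ∧ ∀ s, (∃ τ : M.Strategy, τ.IsOptimalFrom (streett C Z) s) →
      σ.IsOptimalFrom (streett C Z) s := by
  set v := M.optimalValue (streett C Z)
  obtain ⟨g, hg, hwin⟩ := exists_chain_streett_eq_one hM C Z
  have hchoice (s : S) : ∃ p ∈ M.choices s, ∀ t, v s * g s t ≤ p t * v t := by
    obtain hs | hs := eq_or_ne (v s) 0
    · obtain ⟨p, hp⟩ := M.nonempty_choices s
      exact ⟨p, hp, by simp [hs]⟩
    · obtain ⟨p, hp, hpg⟩ := (mem_doobTransform hs).1 (hg s)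
      exact ⟨p, hp, fun t => (hpg t).le⟩
  choose k hk hkg using hchoice
  obtain ⟨σ, hMD, hσ⟩ := exists_isMD_next_eq hk
  refine ⟨σ, hMD, fun s ⟨τ, hτ⟩ => ?_⟩
  have hplay : σ.playMeasure s = chain k s := congrArg (pathMeasure · s) (funext hσ)
  rw [Strategy.IsOptimalFrom, hplay, ← hτ.optimalValue_eq]
  obtain hs | hs := eq_or_ne (v s) 0
  · exact hs.trans_le zero_le
  · calc v s = v s * chain g s (streett C Z) := by rw [hwin s hs, mul_one]
      _ ≤ chain k s (streett C Z) := mul_chain_le (optimalValue_le_one M _) hkg s _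

end Doob

end MDP

theorem mainTheorem1_general {S : Type*} [Countable S] [MeasurableSpace S]
    [DiscreteMeasurableSpace S] (M : MDP S) (hM : ∀ s ∈ M.player, {t | M.step s t}.Finite)
    (col : S → ℕ) (hcol : ∀ s, col s ≤ 2) :
    ∃ σ : M.Strategy, σ.IsMD ∧
      ∀ s : S, (∃ τ : M.Strategy, τ.IsOptimalFrom (MDP.parity col) s) →
        σ.IsOptimalFrom (MDP.parity col) s := by
  rw [MDP.parity_eq_streett hcol]
  exact MDP.exists_isMD_isOptimalFrom_streett hM _ _

theorem mainTheorem1 {S : Type*} [Countable S] [MeasurableSpace S] [DiscreteMeasurableSpace S]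
    (M : MDP S) (hM : M.FinitelyBranching) (col : S → ℕ) (hcol : ∀ s, col s ∈ ({0, 1, 2} : Set ℕ)) :
    ∃ σ : M.Strategy, σ.IsMD ∧
      ∀ s : S, (∃ τ : M.Strategy, τ.IsOptimalFrom (MDP.parity col) s) →
        σ.IsOptimalFrom (MDP.parity col) s :=
  mainTheorem1_general M (fun s _ => hM s) col fun s => by grind
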